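/- **Theorem.** Let $F_1$ and $F_0$ be probability distributions on $\mathbb{R}$ with finite fourth moments, with variances $\sigma_1^2,\sigma_0^2>0$ and kurtoses $\kappa_z = E_{F_z}(Y-\mu_z)^4/\sigma_z^4$ (where $\mu_z$ is the mean of $F_z$), and assume $\kappa_1>1$ and $\kappa_0>1$ (since always $\kappa_z\ge 1$, this excludes only symmetric two-point distributions; it holds for every continuous distribution). For each $N$ consider an experiment on $N$ units of which $N_1=N_1(N)$ are treated and $N_0=N-N_1$ are controls, where $N_1\to\infty$ and $N_0\to\infty$ as $N\to\infty$. The potential outcomes $Y_i(z)$ of unit $i$ have distribution $F_z$, $z\in\{0,1\}$; the pairs $(Y_i(1),Y_i(0))$ are independent across units (the two members of a pair may be dependent); the treatment assignment $(Z_1,\dots,Z_N)$ has exactly $N_1$ entries equal to $1$ almost surely and is independent of all potential outcomes (for example, completely randomized); and $Y_i^{obs}=Z_iY_i(1)+(1-Z_i)Y_i(0)$ is observed. For $z\in\{0,1\}$ let $$\widehat\mu_z=\frac1{N_z}\sum_{i:Z_i=z}Y_i^{obs},\qquad \widehat\sigma_z^2=\frac1{N_z-1}\sum_{i:Z_i=z}(Y_i^{obs}-\widehat\mu_z)^2,\qquad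 \widehat\kappa_z=\frac{\frac1{N_z}\sum_{i:Z_i=z}(Y_i^{obs}-\widehat\mu_z)^4}{\left\{\frac1{N_z}\sum_{i:Z_i=z}(Y_i^{obs}-\widehat\mu_z)^2\right\}^2}.$$ Then, under the null hypothesis of equal variances, $\sigma_1^2=\sigma_0^2$, $$t_{kvar}=\frac{\log\widehat\sigma_1^2-\log\widehat\sigma_0^2}{\sqrt{(\widehat\kappa_1-1)/N_1+(\widehat\kappa_0-1)/N_0}}\ \stackrel{d}{\longrightarrow}\ \mathcal N(0,1)\qquad (N\to\infty).$$ In particular the associated tests are asymptotically distribution-free: for every $c\in\mathbb R$, $P(t_{kvar}>c)\to P(\xi>c)$ and $P(|t_{kvar}|>c)\to P(|\xi|>c)$, where $\xi\sim\mathcal N(0,1)$. (Where a logarithm or quotient is undefined, an event whose probability tends to $0$, the statistic is assigned a measurable conventional value, which does not affect the limits.) -/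

import Mathlib

open MeasureTheory ProbabilityTheory Filter Topology

namespace VarianceRatio

/-- The kurtosis `E (Y - μ)⁴ / (Var Y)²` of a probability distribution `F` on the real line. -/
noncomputable def kurtosis (F : Measure ℝ) : ℝ :=
  centralMoment id 4 F / Var[id; F] ^ 2

section Sample

/-! Statistics computed from the data of one experiment: `z i` is the arm (`1` = treatment,
`0` = control) and `y i` the observed outcome of unit `i`; `a` denotes an arm. -/

/-- The set of units in arm `a`. -/
def arm {N : ℕ} (z : Fin N → Fin 2) (a : Fin 2) : Finset (Fin N) :=
  Finset.univ.filter (fun i => z i = a)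

/-- The number `N_a` of units in arm `a`. -/
def armSize {N : ℕ} (z : Fin N → Fin 2) (a : Fin 2) : ℕ :=
  (arm z a).card

/-- The sample mean of arm `a`. -/
noncomputable def sampleMean {N : ℕ} (z : Fin N → Fin 2) (y : Fin N → ℝ) (a : Fin 2) : ℝ :=
  (∑ i ∈ arm z a, y i) / (armSize z a : ℝ)

/-- The `p`-th sample central moment of arm `a`. -/
noncomputable def sampleCentralMoment {N : ℕ} (z : Fin N → Fin 2) (y : Fin N → ℝ) (a : Fin 2)
    (p : ℕ) : ℝ :=
  (∑ i ∈ arm z a, (y i - sampleMean z y a) ^ p) / (armSize z a : ℝ)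

/-- The sample variance of arm `a`, with divisor `N_a - 1`. -/
noncomputable def sampleVariance {N : ℕ} (z : Fin N → Fin 2) (y : Fin N → ℝ) (a : Fin 2) : ℝ :=
  (∑ i ∈ arm z a, (y i - sampleMean z y a) ^ 2) / ((armSize z a : ℝ) - 1)

/-- The sample kurtosis of arm `a`: the kurtosis of the empirical distribution of that arm. -/
noncomputable def sampleKurtosis {N : ℕ} (z : Fin N → Fin 2) (y : Fin N → ℝ) (a : Fin 2) : ℝ :=
  sampleCentralMoment z y a 4 / sampleCentralMoment z y a 2 ^ 2

/-- The kurtosis-corrected log variance ratio. -/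
noncomputable def tkvar {N : ℕ} (z : Fin N → Fin 2) (y : Fin N → ℝ) : ℝ :=
  (Real.log (sampleVariance z y 1) - Real.log (sampleVariance z y 0)) /
    Real.sqrt ((sampleKurtosis z y 1 - 1) / (armSize z 1 : ℝ)
      + (sampleKurtosis z y 0 - 1) / (armSize z 0 : ℝ))

end Sample

/-- The observed outcomes: unit `i` reveals its potential outcome `Y_i(Z_i)`, that is,
`Z_i Y_i(1) + (1 - Z_i) Y_i(0)`. -/
def observed {Ω : Type*} {N : ℕ} (Y : Fin N → Fin 2 → Ω → ℝ) (Z : Fin N → Ω → Fin 2) (ω : Ω) :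
    Fin N → ℝ :=
  fun i => Y i (Z i ω) ω

/-- A two-arm experiment on `N` units with potential outcomes `Y i 1`, `Y i 0` and treatment
assignment `Z`. The potential outcomes under `a` are drawn from `F a`, independently across units
(the two potential outcomes of one unit may depend on each other in any way); exactly `N₁` units
are treated, and the assignment is independent of the potential outcomes. Complete randomization,
where `Z` is uniform over all assignments with `N₁` treated units, is the main example; a fixed
assignment is another. -/
structure IsExperiment {Ω : Type*} [MeasurableSpace Ω] (P : Measure Ω) (F : Fin 2 → Measure ℝ)
    {N : ℕ} (Y : Fin N → Fin 2 → Ω → ℝ) (Z : Fin N → Ω → Fin 2) (N₁ : ℕ) : Prop where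
  hasLaw : ∀ i a, HasLaw (Y i a) (F a) P
  indep_units : iIndepFun (fun i ω a => Y i a ω) P
  measurable_assignment : ∀ i, Measurable (Z i)
  card_treated : ∀ᵐ ω ∂P, armSize (fun i => Z i ω) 1 = N₁
  indep_assignment : IndepFun (fun ω i => Z i ω) (fun ω i a => Y i a ω) P

end VarianceRatio

namespace VarianceRatio

section ConvergenceInDistribution

variable {Ω Ω' : Type*} [MeasurableSpace Ω] [MeasurableSpace Ω']
  {P : Measure Ω} [IsProbabilityMeasure P] {P' : Measure Ω'} [IsProbabilityMeasure P']
  {X Y : ℕ → Ω → ℝ} {W : Ω' → ℝ}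

theorem tendsto_measure_of_tendstoInDistribution {Ω : ℕ → Type*} [∀ n, MeasurableSpace (Ω n)]
    {P : ∀ n, Measure (Ω n)} [∀ n, IsProbabilityMeasure (P n)] {X : ∀ n, Ω n → ℝ}
    (h : TendstoInDistribution X atTop W P P') {S : Set ℝ} (hS : MeasurableSet S)
    (hfr : P'.map W (frontier S) = 0) :
    Tendsto (fun n => P n (X n ⁻¹' S)) atTop (𝓝 (P'.map W S)) := by
  have := ProbabilityMeasure.tendsto_measure_of_null_frontier_of_tendsto' h.tendsto (E := S) hfr
  refine this.congr fun n => ?_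
  exact Measure.map_apply_of_aemeasurable (h.forall_aemeasurable n) hS

theorem tendstoInMeasure_zero_of_tendstoInDistribution
    (h : TendstoInDistribution X atTop (fun _ => (0 : ℝ)) (fun _ => P) P') :
    TendstoInMeasure P X atTop (fun _ => (0 : ℝ)) := by
  rw [tendstoInMeasure_iff_norm]
  intro ε hε
  have hcl : IsClosed {x : ℝ | ε ≤ ‖x‖} := isClosed_le continuous_const continuous_norm
  have h0 : P'.map (fun _ => (0 : ℝ)) {x : ℝ | ε ≤ ‖x‖} = 0 := by
    rw [Measure.map_apply measurable_const hcl.measurableSet]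
    simp [not_le.2 hε]
  have := tendsto_measure_of_tendstoInDistribution h hcl.measurableSet
    (measure_mono_null hcl.frontier_subset h0)
  rw [h0] at this
  simpa using! this

theorem tendstoInMeasure_of_ae_tendsto {f : ℕ → Ω → ℝ} {c : ℝ} (hf : ∀ n, AEMeasurable (f n) P)
    (h : ∀ᵐ ω ∂P, Tendsto (fun n => f n ω) atTop (𝓝 c)) :
    TendstoInMeasure P f atTop (fun _ => c) :=
  tendstoInMeasure_of_tendsto_ae (fun n => (hf n).aestronglyMeasurable) h

/-- Slutsky's theorem for products. -/
theorem tendstoInDistribution_mul {c : ℝ}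
    (hX : TendstoInDistribution X atTop W (fun _ => P) P')
    (hY : TendstoInMeasure P Y atTop (fun _ => c)) (hYm : ∀ n, AEMeasurable (Y n) P) :
    TendstoInDistribution (fun n ω => Y n ω * X n ω) atTop (fun ω => c * W ω) (fun _ => P) P' :=
  hX.continuous_comp_prodMk_of_tendstoInMeasure_const (g := fun p : ℝ × ℝ => p.2 * p.1)
    (by fun_prop) hY hYm

/-- Slutsky's theorem for sums. -/
theorem tendstoInDistribution_add {c : ℝ}
    (hX : TendstoInDistribution X atTop W (fun _ => P) P')
    (hY : TendstoInMeasure P Y atTop (fun _ => c)) (hYm : ∀ n, AEMeasurable (Y n) P) :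
    TendstoInDistribution (fun n ω => X n ω + Y n ω) atTop (fun ω => W ω + c) (fun _ => P) P' :=
  hX.continuous_comp_prodMk_of_tendstoInMeasure_const (g := fun p : ℝ × ℝ => p.1 + p.2)
    (by fun_prop) hY hYm

theorem TendstoInDistribution.comp_atTop {m : ℕ → ℕ} (hm : Tendsto m atTop atTop)
    (hX : TendstoInDistribution X atTop W (fun _ => P) P') :
    TendstoInDistribution (fun n => X (m n)) atTop W (fun _ => P) P' where
  forall_aemeasurable n := hX.forall_aemeasurable (m n)
  aemeasurable_limit := hX.aemeasurable_limit
  tendsto := hX.tendsto.comp hm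

theorem TendstoInDistribution.tendsto_charFun
    (hX : TendstoInDistribution X atTop W (fun _ => P) P') (t : ℝ) :
    Tendsto (fun n => charFun (P.map (X n)) t) atTop (𝓝 (charFun (P'.map W) t)) :=
  ProbabilityMeasure.tendsto_iff_tendsto_charFun.1 hX.tendsto t

/-- The characteristic functions of scaled asymptotically standard normal variables. -/
theorem tendsto_charFun_const_mul {a : ℕ → ℝ} {a₀ : ℝ} (ha : Tendsto a atTop (𝓝 a₀))
    (hX : TendstoInDistribution X atTop (id : ℝ → ℝ) (fun _ => P) (gaussianReal 0 1)) (t : ℝ) :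
    Tendsto (fun n => charFun (P.map (fun ω => a n * X n ω)) t) atTop
      (𝓝 (Complex.exp (-(a₀ ^ 2 * t ^ 2 / 2 : ℝ)))) := by
  have h := TendstoInDistribution.tendsto_charFun (tendstoInDistribution_mul hX
    (tendstoInMeasure_of_ae_tendsto (f := fun n _ => a n) (fun n => by fun_prop)
      (ae_of_all _ fun _ => ha)) (fun n => by fun_prop)) t
  convert h using 2
  rw [charFun_map_mul_comp (by fun_prop)]
  rw [Measure.map_id, charFun_gaussianReal]
  congr 1
  push_cast
  ring

/-- Normalized linear combinations of independent asymptotically standard normal variables are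
asymptotically standard normal; the coefficients need not converge. -/
theorem tendstoInDistribution_mul_sub_mul {a b : ℕ → ℝ} (hab : ∀ n, a n ^ 2 + b n ^ 2 = 1)
    (hX : TendstoInDistribution X atTop (id : ℝ → ℝ) (fun _ => P) (gaussianReal 0 1))
    (hY : TendstoInDistribution Y atTop (id : ℝ → ℝ) (fun _ => P) (gaussianReal 0 1))
    (hind : ∀ n, IndepFun (X n) (Y n) P) :
    TendstoInDistribution (fun n ω => a n * X n ω - b n * Y n ω) atTop (id : ℝ → ℝ)
      (fun _ => P) (gaussianReal 0 1) where
  forall_aemeasurable n :=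
    ((hX.forall_aemeasurable n).const_mul _).sub ((hY.forall_aemeasurable n).const_mul _)
  tendsto := by
    refine ProbabilityMeasure.tendsto_iff_tendsto_charFun.2 fun t => ?_
    simp only [ProbabilityMeasure.coe_mk, Measure.map_id, charFun_gaussianReal]
    refine tendsto_of_subseq_tendsto fun ns hns => ?_
    have hbd : ∀ n, (a (ns n), b (ns n)) ∈ Set.Icc (-1 : ℝ) 1 ×ˢ Set.Icc (-1 : ℝ) 1 := by
      intro n
      have := hab (ns n)
      refine ⟨⟨?_, ?_⟩, ⟨?_, ?_⟩⟩ <;> simp only <;>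
        nlinarith [sq_nonneg (a (ns n)), sq_nonneg (b (ns n))]
    obtain ⟨⟨a₀, b₀⟩, -, ms, hms, hlim⟩ :=
      (isCompact_Icc.prod isCompact_Icc).tendsto_subseq hbd
    have ha : Tendsto (fun n => a (ns (ms n))) atTop (𝓝 a₀) := hlim.fst_nhds
    have hb : Tendsto (fun n => b (ns (ms n))) atTop (𝓝 b₀) := hlim.snd_nhds
    have hab₀ : a₀ ^ 2 + b₀ ^ 2 = 1 :=
      tendsto_nhds_unique ((ha.pow 2).add (hb.pow 2)) (by simp [hab])
    refine ⟨ms, ?_⟩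
    have hsub := hns.comp hms.tendsto_atTop
    have h1 := tendsto_charFun_const_mul ha (TendstoInDistribution.comp_atTop hsub hX) t
    have h2 := tendsto_charFun_const_mul hb.neg (TendstoInDistribution.comp_atTop hsub hY) t
    have h3 := h1.mul h2
    rw [← Complex.exp_add] at h3
    have hlimit : (-(a₀ ^ 2 * t ^ 2 / 2 : ℝ) + -((-b₀) ^ 2 * t ^ 2 / 2 : ℝ) : ℂ)
        = t * (0 : ℝ) * Complex.I - (1 : NNReal) * t ^ 2 / 2 := by
      have : ((a₀ : ℂ) ^ 2 + (b₀ : ℂ) ^ 2) = 1 := by exact_mod_cast hab₀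
      push_cast
      linear_combination (-(t : ℂ) ^ 2 / 2) * this
    rw [hlimit] at h3
    refine h3.congr fun n => ?_
    set k := ns (ms n)
    have hind' : IndepFun (fun ω => a k * X k ω) (fun ω => -b k * Y k ω) P :=
      (hind k).comp (φ := fun x => a k * x) (ψ := fun x => -b k * x) (by fun_prop) (by fun_prop)
    have := congrFun (hind'.charFun_map_fun_add_eq_mul
      ((hX.forall_aemeasurable k).const_mul _) ((hY.forall_aemeasurable k).const_mul _)) t
    simp only [Pi.mul_apply] at this
    simp only [Function.comp_apply]
    rw [← this]
    simp only [neg_mul, ← sub_eq_add_neg]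

end ConvergenceInDistribution

section SequenceStatistics

/-- The average of the first `n` terms of a sequence. -/
noncomputable def avg (n : ℕ) (u : ℕ → ℝ) : ℝ :=
  (∑ j ∈ Finset.range n, u j) / n

/-- The `p`-th sample central moment of the first `n` terms of a sequence. -/
noncomputable def seqCentralMoment (n : ℕ) (u : ℕ → ℝ) (p : ℕ) : ℝ :=
  avg n (fun j => (u j - avg n u) ^ p)

/-- The sample variance of the first `n` terms of a sequence, with divisor `n - 1`. -/
noncomputable def seqVariance (n : ℕ) (u : ℕ → ℝ) : ℝ :=
  (∑ j ∈ Finset.range n, (u j - avg n u) ^ 2) / ((n : ℝ) - 1)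

/-- The sample kurtosis of the first `n` terms of a sequence. -/
noncomputable def seqKurtosis (n : ℕ) (u : ℕ → ℝ) : ℝ :=
  seqCentralMoment n u 4 / seqCentralMoment n u 2 ^ 2

@[fun_prop]
theorem measurable_avg (n : ℕ) : Measurable (avg n) := by
  unfold avg
  fun_prop

@[fun_prop]
theorem measurable_seqVariance (n : ℕ) : Measurable (seqVariance n) := by
  unfold seqVariance avg
  fun_prop

@[fun_prop]
theorem measurable_seqKurtosis (n : ℕ) : Measurable (seqKurtosis n) := by
  unfold seqKurtosis seqCentralMoment avg
  fun_prop

theorem avg_sub_const {n : ℕ} (hn : n ≠ 0) (u : ℕ → ℝ) (c : ℝ) :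
    avg n (fun j => u j - c) = avg n u - c := by
  have : (n : ℝ) ≠ 0 := by exact_mod_cast hn
  simp only [avg, Finset.sum_sub_distrib, Finset.sum_const, Finset.card_range, nsmul_eq_mul]
  field_simp

theorem avg_sub_sq {n : ℕ} (hn : n ≠ 0) (x : ℕ → ℝ) (m : ℝ) :
    avg n (fun j => (x j - m) ^ 2)
      = avg n (fun j => x j ^ 2) - 2 * m * avg n (fun j => x j) + m ^ 2 := by
  have hsum : ∑ j ∈ Finset.range n, (x j - m) ^ 2 = ∑ j ∈ Finset.range n, x j ^ 2
      - 2 * m * ∑ j ∈ Finset.range n, x j + n * m ^ 2 := by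
    clear hn
    induction n with
    | zero => simp
    | succ n ih =>
      simp only [Finset.sum_range_succ]
      push_cast
      linear_combination ih
  have : (n : ℝ) ≠ 0 := by exact_mod_cast hn
  simp only [avg, hsum]
  field_simp

theorem avg_sub_pow_four {n : ℕ} (hn : n ≠ 0) (x : ℕ → ℝ) (m : ℝ) :
    avg n (fun j => (x j - m) ^ 4)
      = avg n (fun j => x j ^ 4) - 4 * m * avg n (fun j => x j ^ 3)
        + 6 * m ^ 2 * avg n (fun j => x j ^ 2) - 4 * m ^ 3 * avg n (fun j => x j) + m ^ 4 := by
  have hsum : ∑ j ∈ Finset.range n, (x j - m) ^ 4 = ∑ j ∈ Finset.range n, x j ^ 4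
      - 4 * m * ∑ j ∈ Finset.range n, x j ^ 3 + 6 * m ^ 2 * ∑ j ∈ Finset.range n, x j ^ 2
      - 4 * m ^ 3 * ∑ j ∈ Finset.range n, x j + n * m ^ 4 := by
    clear hn
    induction n with
    | zero => simp
    | succ n ih =>
      simp only [Finset.sum_range_succ]
      push_cast
      linear_combination ih
  have : (n : ℝ) ≠ 0 := by exact_mod_cast hn
  simp only [avg, hsum]
  field_simp

/-- The sample central moments are unchanged by a translation of the data. -/
theorem seqCentralMoment_sub_const {n : ℕ} (u : ℕ → ℝ) (p : ℕ) (c : ℝ) :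
    seqCentralMoment n u p
      = avg n (fun j => ((u j - c) - avg n (fun j => u j - c)) ^ p) := by
  rcases eq_or_ne n 0 with rfl | hn
  · simp [seqCentralMoment, avg]
  · simp only [seqCentralMoment, avg_sub_const hn, sub_sub_sub_cancel_right]

theorem seqCentralMoment_two {n : ℕ} (u : ℕ → ℝ) (c : ℝ) :
    seqCentralMoment n u 2
      = avg n (fun j => (u j - c) ^ 2) - avg n (fun j => u j - c) ^ 2 := by
  rcases eq_or_ne n 0 with rfl | hn
  · simp [seqCentralMoment, avg]
  rw [seqCentralMoment_sub_const u 2 c, avg_sub_sq hn]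
  ring

theorem seqCentralMoment_four {n : ℕ} (u : ℕ → ℝ) (c : ℝ) :
    seqCentralMoment n u 4
      = avg n (fun j => (u j - c) ^ 4)
        - 4 * avg n (fun j => u j - c) * avg n (fun j => (u j - c) ^ 3)
        + 6 * avg n (fun j => u j - c) ^ 2 * avg n (fun j => (u j - c) ^ 2)
        - 3 * avg n (fun j => u j - c) ^ 4 := by
  rcases eq_or_ne n 0 with rfl | hn
  · simp [seqCentralMoment, avg]
  rw [seqCentralMoment_sub_const u 4 c, avg_sub_pow_four hn]
  ring

theorem seqVariance_eq (n : ℕ) (u : ℕ → ℝ) :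
    seqVariance n u = (n / ((n : ℝ) - 1)) * seqCentralMoment n u 2 := by
  rcases eq_or_ne n 0 with rfl | hn
  · simp [seqVariance]
  have : (n : ℝ) ≠ 0 := by exact_mod_cast hn
  simp only [seqVariance, seqCentralMoment, avg]
  rw [div_mul_div_comm, mul_comm ((n : ℝ) - 1), mul_div_mul_left _ _ this]

end SequenceStatistics

theorem tendsto_natCast_div_sub_one :
    Tendsto (fun n : ℕ => (n : ℝ) / ((n : ℝ) - 1)) atTop (𝓝 1) := by
  have h : Tendsto (fun n : ℕ => 1 + ((n : ℝ) - 1)⁻¹) atTop (𝓝 (1 + 0)) :=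
    tendsto_const_nhds.add (tendsto_inv_atTop_zero.comp
      (tendsto_atTop_add_const_right _ (-1) tendsto_natCast_atTop_atTop))
  rw [add_zero] at h
  refine h.congr' ?_
  filter_upwards [eventually_ge_atTop 2] with n hn
  have : (2 : ℝ) ≤ n := by exact_mod_cast hn
  have : (n : ℝ) - 1 ≠ 0 := by linarith
  field_simp
  ring

theorem tendsto_sqrt_mul_div_sub_one :
    Tendsto (fun n : ℕ => √(n : ℝ) * ((n : ℝ) / ((n : ℝ) - 1) - 1)) atTop (𝓝 0) := by
  have h : Tendsto (fun n : ℕ => (√(n : ℝ))⁻¹ * ((n : ℝ) / ((n : ℝ) - 1))) atTop (𝓝 (0 * 1)) :=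
    (tendsto_inv_atTop_zero.comp <| Real.tendsto_sqrt_atTop.comp
      tendsto_natCast_atTop_atTop).mul tendsto_natCast_div_sub_one
  rw [zero_mul] at h
  refine h.congr' ?_
  filter_upwards [eventually_ge_atTop 2] with n hn
  have h2 : (2 : ℝ) ≤ n := by exact_mod_cast hn
  have h3 : (n : ℝ) - 1 ≠ 0 := by linarith
  have h4 : √(n : ℝ) ≠ 0 := by positivity
  have h5 : √(n : ℝ) ^ 2 = n := Real.sq_sqrt (by positivity)
  field_simp
  rw [h5]
  ring

section Moments

theorem variance_pos_of_one_lt_kurtosis {F : Measure ℝ} (hκ : 1 < kurtosis F) : 0 < Var[id; F] := by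
  refine lt_of_le_of_ne (variance_nonneg _ _) fun h => ?_
  rw [kurtosis, ← h] at hκ
  norm_num at hκ

theorem memLp_sub_const {F : Measure ℝ} [IsProbabilityMeasure F]
    (hF4 : MemLp id 4 F) : MemLp (fun x => x - F[id]) 4 F :=
  hF4.sub (memLp_const _)

theorem integrable_sub_pow {F : Measure ℝ} [IsProbabilityMeasure F]
    (hF4 : MemLp id 4 F) {p : ℕ} (hp : p ≤ 4) :
    Integrable (fun x => (x - F[id]) ^ p) F := by
  have h4 : MemLp (fun x => x - F[id]) (p : ENNReal) F :=
    (memLp_sub_const hF4).mono_exponent (by exact_mod_cast hp)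
  rcases eq_or_ne p 0 with rfl | hp0
  · simp
  · refine (h4.integrable_norm_pow hp0).mono' (by fun_prop) (ae_of_all _ fun x => ?_)
    simp

theorem integral_sub_sq (F : Measure ℝ) : ∫ x, (x - F[id]) ^ 2 ∂F = Var[id; F] := by
  rw [variance_eq_integral (by fun_prop)]
  rfl

theorem integral_sub_pow_four {F : Measure ℝ} (hκ : 1 < kurtosis F) :
    ∫ x, (x - F[id]) ^ 4 ∂F = kurtosis F * Var[id; F] ^ 2 := by
  have h := variance_pos_of_one_lt_kurtosis hκ
  rw [kurtosis, div_mul_cancel₀ _ (by positivity)]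
  rfl

theorem integral_sub_self {F : Measure ℝ} [IsProbabilityMeasure F]
    (hF4 : MemLp id 4 F) : ∫ x, (x - F[id]) ∂F = 0 := by
  have : Integrable (fun x => x) F := (hF4.mono_exponent (q := 4) (p := 1) (by norm_num)).integrable le_rfl
  rw [integral_sub this (integrable_const _)]
  simp

end Moments

section IIDSample

variable {Ω : Type*} [MeasurableSpace Ω] {Q : Measure Ω} {F : Measure ℝ} {X : ℕ → Ω → ℝ}

theorem integral_comp_sample (hm : ∀ j, Measurable (X j)) (hlaw : ∀ j, Q.map (X j) = F)
    {g : ℝ → ℝ} (hg : Measurable g) (j : ℕ) : ∫ ω, g (X j ω) ∂Q = ∫ x, g x ∂F := by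
  rw [← hlaw j, integral_map (hm j).aemeasurable hg.aestronglyMeasurable]

theorem identDistrib_comp_sample (hm : ∀ j, Measurable (X j)) (hlaw : ∀ j, Q.map (X j) = F)
    {g : ℝ → ℝ} (hg : Measurable g) (j : ℕ) :
    IdentDistrib (fun ω => g (X j ω)) (fun ω => g (X 0 ω)) Q Q :=
  IdentDistrib.comp (u := g) ⟨(hm j).aemeasurable, (hm 0).aemeasurable, by rw [hlaw, hlaw]⟩ hg

theorem ae_tendsto_avg_comp (hm : ∀ j, Measurable (X j)) (hlaw : ∀ j, Q.map (X j) = F)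
    (hind : iIndepFun X Q) {g : ℝ → ℝ} (hg : Measurable g) (hint : Integrable g F) :
    ∀ᵐ ω ∂Q, Tendsto (fun n => avg n (fun j => g (X j ω))) atTop (𝓝 (∫ x, g x ∂F)) := by
  have hi : Integrable (fun ω => g (X 0 ω)) Q := by
    rw [← hlaw 0] at hint
    exact hint.comp_measurable (hm 0)
  have := strong_law_ae_real (fun j ω => g (X j ω)) hi
    (fun i j hij => (hind.indepFun hij).comp hg hg) (identDistrib_comp_sample hm hlaw hg)
  rwa [integral_comp_sample hm hlaw hg] at this

variable [IsProbabilityMeasure F]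

theorem ae_tendsto_avg_sub_pow (hF4 : MemLp id 4 F) (hm : ∀ j, Measurable (X j))
    (hlaw : ∀ j, Q.map (X j) = F) (hind : iIndepFun X Q) {p : ℕ} (hp : p ≤ 4) :
    ∀ᵐ ω ∂Q, Tendsto (fun n => avg n (fun j => (X j ω - F[id]) ^ p)) atTop
      (𝓝 (∫ x, (x - F[id]) ^ p ∂F)) := by
  have hint := integrable_sub_pow hF4 hp
  generalize F[id] = m at *
  exact ae_tendsto_avg_comp hm hlaw hind (g := fun x => (x - m) ^ p) (by fun_prop) hint

theorem ae_tendsto_avg_sub (hF4 : MemLp id 4 F) (hm : ∀ j, Measurable (X j))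
    (hlaw : ∀ j, Q.map (X j) = F) (hind : iIndepFun X Q) :
    ∀ᵐ ω ∂Q, Tendsto (fun n => avg n (fun j => X j ω - F[id])) atTop (𝓝 0) := by
  have := ae_tendsto_avg_sub_pow hF4 hm hlaw hind (p := 1) (by norm_num)
  simpa only [pow_one, integral_sub_self hF4] using this

theorem ae_tendsto_seqCentralMoment_two (hF4 : MemLp id 4 F) (hm : ∀ j, Measurable (X j))
    (hlaw : ∀ j, Q.map (X j) = F) (hind : iIndepFun X Q) :
    ∀ᵐ ω ∂Q, Tendsto (fun n => seqCentralMoment n (fun j => X j ω) 2) atTop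
      (𝓝 Var[id; F]) := by
  filter_upwards [ae_tendsto_avg_sub hF4 hm hlaw hind,
    ae_tendsto_avg_sub_pow hF4 hm hlaw hind (p := 2) (by norm_num)] with ω h1 h2
  simp only [seqCentralMoment_two _ F[id]]
  rw [integral_sub_sq] at h2
  simpa using h2.sub (h1.pow 2)

theorem ae_tendsto_seqVariance (hF4 : MemLp id 4 F) (hm : ∀ j, Measurable (X j))
    (hlaw : ∀ j, Q.map (X j) = F) (hind : iIndepFun X Q) :
    ∀ᵐ ω ∂Q, Tendsto (fun n => seqVariance n (fun j => X j ω)) atTop (𝓝 Var[id; F]) := by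
  filter_upwards [ae_tendsto_seqCentralMoment_two hF4 hm hlaw hind] with ω h
  simp only [seqVariance_eq]
  simpa using tendsto_natCast_div_sub_one.mul h

theorem ae_tendsto_seqKurtosis (hF4 : MemLp id 4 F) (hκ : 1 < kurtosis F)
    (hm : ∀ j, Measurable (X j)) (hlaw : ∀ j, Q.map (X j) = F) (hind : iIndepFun X Q) :
    ∀ᵐ ω ∂Q, Tendsto (fun n => seqKurtosis n (fun j => X j ω)) atTop (𝓝 (kurtosis F)) := by
  have hσ := variance_pos_of_one_lt_kurtosis hκ
  filter_upwards [ae_tendsto_avg_sub hF4 hm hlaw hind,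
    ae_tendsto_avg_sub_pow hF4 hm hlaw hind (p := 2) (by norm_num),
    ae_tendsto_avg_sub_pow hF4 hm hlaw hind (p := 3) (by norm_num),
    ae_tendsto_avg_sub_pow hF4 hm hlaw hind (p := 4) le_rfl,
    ae_tendsto_seqCentralMoment_two hF4 hm hlaw hind] with ω h1 h2 h3 h4 hv
  have hfour : Tendsto (fun n => seqCentralMoment n (fun j => X j ω) 4) atTop
      (𝓝 (kurtosis F * Var[id; F] ^ 2)) := by
    simp only [seqCentralMoment_four _ F[id]]
    rw [integral_sub_pow_four hκ] at h4
    simpa using ((h4.sub ((h1.const_mul 4).mul h3)).add (((h1.pow 2).const_mul 6).mul h2)).sub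
      ((h1.pow 4).const_mul 3)
  have := hfour.div (hv.pow 2) (by positivity)
  rwa [mul_div_cancel_right₀ _ (by positivity)] at this

variable [IsProbabilityMeasure Q]

/-- `√n` times the squared deviation of the sample mean from the mean is asymptotically
negligible. -/
theorem tendstoInMeasure_sqrt_mul_avg_sq (hF4 : MemLp id 4 F) (hm : ∀ j, Measurable (X j))
    (hlaw : ∀ j, Q.map (X j) = F) (hind : iIndepFun X Q) :
    TendstoInMeasure Q (fun (n : ℕ) ω => √(n : ℝ) * avg n (fun j => X j ω - F[id]) ^ 2) atTop
      (fun _ => (0 : ℝ)) := by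
  have hL : MemLp (X 0) 2 Q := by
    have : MemLp id 2 F := hF4.mono_exponent (by norm_num)
    rw [← hlaw 0] at this
    exact this.comp_of_map (hm 0).aemeasurable
  have hclt := tendstoInDistribution_inv_sqrt_mul_sum_sub (P' := gaussianReal 0 Var[X 0; Q].toNNReal)
    (Y := id) HasLaw.id hL hind (fun j => identDistrib_comp_sample hm hlaw measurable_id j)
  have hmean : Q[X 0] = F[id] := integral_comp_sample hm hlaw measurable_id 0
  rw [hmean] at hclt
  have hmeas : ∀ n : ℕ, AEMeasurable (fun ω => avg n (fun j => X j ω - F[id])) Q := fun n =>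
    ((measurable_avg n).comp (by fun_prop)).aemeasurable
  have h := tendstoInDistribution_mul hclt (tendstoInMeasure_of_ae_tendsto hmeas
    (ae_tendsto_avg_sub hF4 hm hlaw hind)) hmeas
  simp only [zero_mul] at h
  refine (tendstoInMeasure_zero_of_tendstoInDistribution h).congr_left fun n => ae_of_all _ fun ω => ?_
  simp only [avg, Finset.sum_sub_distrib, Finset.sum_const, Finset.card_range, nsmul_eq_mul]
  rcases eq_or_ne n 0 with rfl | hn
  · simp
  have h4 : √(n : ℝ) ≠ 0 := by positivity
  have h5 : √(n : ℝ) ^ 2 = n := Real.sq_sqrt (by positivity)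
  generalize ∑ j ∈ Finset.range n, X j ω - n * F[id] = A
  field_simp
  rw [h5]

/-- The central limit theorem for the standardized average squared deviation from the mean. -/
theorem tendstoInDistribution_avg_sub_sq (hF4 : MemLp id 4 F) (hκ : 1 < kurtosis F)
    (hm : ∀ j, Measurable (X j)) (hlaw : ∀ j, Q.map (X j) = F) (hind : iIndepFun X Q) :
    TendstoInDistribution (fun (n : ℕ) ω => √(n : ℝ)
        * (avg n (fun j => (X j ω - F[id]) ^ 2) - Var[id; F])
        / (Var[id; F] * √(kurtosis F - 1))) atTop (id : ℝ → ℝ) (fun _ => Q)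
      (gaussianReal 0 1) := by
  have hσ := variance_pos_of_one_lt_kurtosis hκ
  have hv : 0 < √(kurtosis F - 1) := Real.sqrt_pos.2 (by linarith)
  have hv2 : √(kurtosis F - 1) ^ 2 = kurtosis F - 1 := Real.sq_sqrt (by linarith)
  set c := Var[id; F] * √(kurtosis F - 1) with hc
  have hc0 : c ≠ 0 := by positivity
  let g : ℝ → ℝ := fun x => ((x - F[id]) ^ 2 - Var[id; F]) / c
  have hg : Measurable g := by fun_prop
  have h0 : ∫ ω, g (X 0 ω) ∂Q = 0 := by
    rw [integral_comp_sample hm hlaw hg, integral_div,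
      integral_sub (integrable_sub_pow hF4 (by norm_num)) (integrable_const _), integral_sub_sq]
    simp
  have h1 : ∫ ω, (g (X 0 ω)) ^ 2 ∂Q = 1 := by
    rw [integral_comp_sample hm hlaw (g := fun x => g x ^ 2) (hg.pow_const 2)]
    have hexp : ∀ x, g x ^ 2 = ((x - F[id]) ^ 4 - 2 * Var[id; F] * (x - F[id]) ^ 2
        + Var[id; F] ^ 2) / c ^ 2 := fun x => by
      simp only [g, div_pow]
      ring
    simp_rw [hexp]
    have i4 := integrable_sub_pow hF4 (p := 4) le_rfl
    have i2 := (integrable_sub_pow hF4 (p := 2) (by norm_num)).const_mul (2 * Var[id; F])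
    have i42 : Integrable (fun x => (x - F[id]) ^ 4 - 2 * Var[id; F] * (x - F[id]) ^ 2) F :=
      i4.sub i2
    rw [integral_div, integral_add i42 (integrable_const _), integral_sub i4 i2,
      integral_const_mul, integral_sub_sq, integral_sub_pow_four hκ]
    rw [div_eq_one_iff_eq (by positivity), hc, mul_pow, hv2]
    simp
    ring
  refine (tendstoInDistribution_inv_sqrt_mul_sum (Y := id) (P' := gaussianReal 0 1) HasLaw.id
    h0 h1 (hind.comp (fun _ => g) fun _ => hg) (identDistrib_comp_sample hm hlaw hg)).congr
    (fun n => ae_of_all _ fun ω => ?_) (ae_of_all _ fun _ => rfl)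
  rcases eq_or_ne n 0 with rfl | hn
  · simp
  have h4 : √(n : ℝ) ≠ 0 := by positivity
  have h5 : √(n : ℝ) ^ 2 = (n : ℝ) := Real.sq_sqrt (by positivity)
  have h6 : (n : ℝ) ≠ 0 := by positivity
  simp only [Function.comp_apply, g, avg, ← Finset.sum_div, Finset.sum_sub_distrib,
    Finset.sum_const, Finset.card_range, nsmul_eq_mul]
  field_simp
  rw [h5]

/-- The standardized logarithm of the sample variance. -/
noncomputable def logVarianceStat (F : Measure ℝ) (n : ℕ) (u : ℕ → ℝ) : ℝ :=
  √(n : ℝ) * (Real.log (seqVariance n u) - Real.log Var[id; F]) / √(kurtosis F - 1)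

@[fun_prop]
theorem measurable_logVarianceStat (F : Measure ℝ) (n : ℕ) :
    Measurable (logVarianceStat F n) := by
  unfold logVarianceStat
  fun_prop

/-- Delta method for the logarithm of the sample variance. -/
theorem tendstoInDistribution_logVarianceStat (hF4 : MemLp id 4 F) (hκ : 1 < kurtosis F)
    (hm : ∀ j, Measurable (X j)) (hlaw : ∀ j, Q.map (X j) = F) (hind : iIndepFun X Q) :
    TendstoInDistribution (fun n ω => logVarianceStat F n (fun j => X j ω)) atTop
      (id : ℝ → ℝ) (fun _ => Q) (gaussianReal 0 1) := by
  have hσ := variance_pos_of_one_lt_kurtosis hκ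
  have hv : 0 < √(kurtosis F - 1) := Real.sqrt_pos.2 (by linarith)
  set v := √(kurtosis F - 1)
  set s := Var[id; F]
  have hXm : Measurable fun ω j => X j ω := measurable_pi_lambda _ hm
  have hem : ∀ n : ℕ, AEMeasurable
      (fun ω => -(s * v)⁻¹ * (√(n : ℝ) * avg n (fun j => X j ω - F[id]) ^ 2)) Q := fun n =>
    ((((measurable_avg n).comp (by fun_prop)).pow_const 2).const_mul _ |>.const_mul _).aemeasurable
  have he : TendstoInMeasure Q
      (fun (n : ℕ) ω => -(s * v)⁻¹ * (√(n : ℝ) * avg n (fun j => X j ω - F[id]) ^ 2)) atTop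
      (fun _ => (0 : ℝ)) := by
    have hneg := tendstoInDistribution_mul
      ((tendstoInMeasure_sqrt_mul_avg_sq hF4 hm hlaw hind).tendstoInDistribution
        (fun n : ℕ => ((((measurable_avg n).comp (by fun_prop)).pow_const 2).const_mul _).aemeasurable))
      (tendstoInMeasure_of_ae_tendsto (f := fun _ _ => -(s * v)⁻¹)
        (fun _ => aemeasurable_const) (ae_of_all _ fun _ => tendsto_const_nhds))
      (fun _ => aemeasurable_const)
    simp only [mul_zero] at hneg
    exact tendstoInMeasure_zero_of_tendstoInDistribution hneg
  have h1 := tendstoInDistribution_add (tendstoInDistribution_avg_sub_sq hF4 hκ hm hlaw hind)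
    he hem
  have h2 := tendstoInDistribution_mul h1 (tendstoInMeasure_of_ae_tendsto
    (f := fun n _ => (n : ℝ) / ((n : ℝ) - 1)) (fun n => by fun_prop)
    (ae_of_all _ fun _ => tendsto_natCast_div_sub_one)) (fun n => by fun_prop)
  have h3 := tendstoInDistribution_add h2 (tendstoInMeasure_of_ae_tendsto
    (f := fun n _ => √(n : ℝ) * ((n : ℝ) / ((n : ℝ) - 1) - 1) * v⁻¹) (fun n => by fun_prop)
    (ae_of_all _ fun _ => tendsto_sqrt_mul_div_sub_one.mul_const _)) (fun n => by fun_prop)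
  have hlog : DifferentiableAt ℝ Real.log s := Real.differentiableAt_log hσ.ne'
  let k : ℕ → Ω → ℝ := fun n ω => s * dslope Real.log s (seqVariance n fun j => X j ω)
  have hk : ∀ᵐ ω ∂Q, Tendsto (fun n => k n ω) atTop (𝓝 1) := by
    filter_upwards [ae_tendsto_seqVariance hF4 hm hlaw hind] with ω hω
    have := (((continuousAt_dslope_same.2 hlog).tendsto.comp hω).const_mul s)
    rwa [dslope_same, Real.deriv_log, mul_inv_cancel₀ hσ.ne'] at this
  have hdm : Measurable (dslope Real.log s) := by
    have : dslope Real.log s = fun x => if x = s then deriv Real.log s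
        else (x - s)⁻¹ * (Real.log x - Real.log s) := by
      funext x
      simp [dslope, Function.update_apply, slope_def_module]
    rw [this]
    exact Measurable.ite (measurableSet_singleton s) measurable_const (by fun_prop)
  have hkm : ∀ n, AEMeasurable (k n) Q := fun n =>
    ((hdm.comp ((measurable_seqVariance n).comp hXm)).const_mul s).aemeasurable
  have h4 := tendstoInDistribution_mul h3 (tendstoInMeasure_of_ae_tendsto hkm hk) hkm
  refine h4.congr (fun n => ae_of_all _ fun ω => ?_) (ae_of_all _ fun x => ?_)
  · simp only [k, logVarianceStat]
    have hd := sub_smul_dslope Real.log s (seqVariance n fun j => X j ω)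
    change _ = √(n : ℝ) * (_ - Real.log s) / v
    change _ * (_ * (√(n : ℝ) * (_ - s) / (s * v) + _) + _) = _
    rw [← hd, smul_eq_mul]
    generalize dslope Real.log s (seqVariance n fun j => X j ω) = d
    rw [seqVariance_eq, seqCentralMoment_two _ F[id]]
    generalize avg n (fun j => (X j ω - F[id]) ^ 2) = m₂
    generalize avg n (fun j => X j ω - F[id]) = m₁
    generalize (n : ℝ) / ((n : ℝ) - 1) = c
    field_simp
    ring
  · simp

end IIDSample

section TwoSamples

/-- The kurtosis-corrected log variance ratio of the first `n` terms of `u` and the first `m`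
terms of `w`. -/
noncomputable def seqTkvar (n m : ℕ) (u w : ℕ → ℝ) : ℝ :=
  (Real.log (seqVariance n u) - Real.log (seqVariance m w)) /
    √((seqKurtosis n u - 1) / n + (seqKurtosis m w - 1) / m)

theorem seqTkvar_eq {F G : Measure ℝ} (hF : 1 < kurtosis F) (hG : 1 < kurtosis G)
    (hvar : Var[id; F] = Var[id; G]) {n m : ℕ} (hn : n ≠ 0) (hm : m ≠ 0) {D a b : ℝ}
    (hD0 : 0 < D)
    (ha : a = √(kurtosis F - 1) / √(n : ℝ) / D) (hb : b = √(kurtosis G - 1) / √(m : ℝ) / D)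
    (u w : ℕ → ℝ) :
    seqTkvar n m u w = (√(a ^ 2 * ((seqKurtosis n u - 1) / (kurtosis F - 1))
        + b ^ 2 * ((seqKurtosis m w - 1) / (kurtosis G - 1))))⁻¹
      * (a * logVarianceStat F n u - b * logVarianceStat G m w) := by
  have hF0 : 0 < kurtosis F - 1 := by linarith
  have hG0 : 0 < kurtosis G - 1 := by linarith
  have hn0 : (0 : ℝ) < n := by positivity
  have hm0 : (0 : ℝ) < m := by positivity
  have hr : a ^ 2 * ((seqKurtosis n u - 1) / (kurtosis F - 1))
      + b ^ 2 * ((seqKurtosis m w - 1) / (kurtosis G - 1))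
      = ((seqKurtosis n u - 1) / n + (seqKurtosis m w - 1) / m) / D ^ 2 := by
    rw [ha, hb]
    simp only [div_pow, Real.sq_sqrt hF0.le, Real.sq_sqrt hG0.le, Real.sq_sqrt hn0.le,
      Real.sq_sqrt hm0.le]
    field_simp
  have h1 : a * logVarianceStat F n u
      = (Real.log (seqVariance n u) - Real.log Var[id; F]) / D := by
    have := Real.sqrt_pos.2 hF0
    have := Real.sqrt_pos.2 hn0
    rw [ha, logVarianceStat]
    field_simp
  have h2 : b * logVarianceStat G m w
      = (Real.log (seqVariance m w) - Real.log Var[id; G]) / D := by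
    have := Real.sqrt_pos.2 hG0
    have := Real.sqrt_pos.2 hm0
    rw [hb, logVarianceStat]
    field_simp
  rw [hr, h1, h2, hvar, seqTkvar, Real.sqrt_div' _ (by positivity), Real.sqrt_sq hD0.le,
    ← sub_div, sub_sub_sub_cancel_right, inv_div]
  field_simp

theorem measurable_seqTkvar (n m : ℕ) :
    Measurable (fun p : (ℕ → ℝ) × (ℕ → ℝ) => seqTkvar n m p.1 p.2) := by
  unfold seqTkvar
  fun_prop

theorem TendstoInDistribution.congr_eventually {Ω Ω' : Type*} [MeasurableSpace Ω]
    [MeasurableSpace Ω'] {P : Measure Ω} [IsProbabilityMeasure P] {P' : Measure Ω'}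
    [IsProbabilityMeasure P'] {X Y : ℕ → Ω → ℝ} {W : Ω' → ℝ}
    (hX : TendstoInDistribution X atTop W (fun _ => P) P') (hXY : ∀ᶠ n in atTop, X n = Y n)
    (hY : ∀ n, AEMeasurable (Y n) P) :
    TendstoInDistribution Y atTop W (fun _ => P) P' where
  forall_aemeasurable := hY
  aemeasurable_limit := hX.aemeasurable_limit
  tendsto := by
    refine hX.tendsto.congr' ?_
    filter_upwards [hXY] with n hn
    exact Subtype.ext (congrArg P.map hn)

variable {Ω : Type*} [MeasurableSpace Ω] {Q : Measure Ω} [IsProbabilityMeasure Q]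
  {F G : Measure ℝ} [IsProbabilityMeasure F] [IsProbabilityMeasure G] {X Y : ℕ → Ω → ℝ}

theorem tendstoInDistribution_seqTkvar (hF4 : MemLp id 4 F) (hG4 : MemLp id 4 G)
    (hF : 1 < kurtosis F) (hG : 1 < kurtosis G) (hvar : Var[id; F] = Var[id; G])
    (hXm : ∀ j, Measurable (X j)) (hYm : ∀ j, Measurable (Y j))
    (hXlaw : ∀ j, Q.map (X j) = F) (hYlaw : ∀ j, Q.map (Y j) = G)
    (hXind : iIndepFun X Q) (hYind : iIndepFun Y Q)
    (hXY : IndepFun (fun ω j => X j ω) (fun ω j => Y j ω) Q)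
    {n m : ℕ → ℕ} (hn : Tendsto n atTop atTop) (hm : Tendsto m atTop atTop) :
    TendstoInDistribution
      (fun N ω => seqTkvar (n N) (m N) (fun j => X j ω) (fun j => Y j ω)) atTop
      (id : ℝ → ℝ) (fun _ => Q) (gaussianReal 0 1) := by
  have hF0 : 0 < kurtosis F - 1 := by linarith
  have hG0 : 0 < kurtosis G - 1 := by linarith
  let D : ℕ → ℝ := fun N => √((kurtosis F - 1) / n N + (kurtosis G - 1) / m N)
  let a : ℕ → ℝ := fun N => if D N = 0 then 1 else √(kurtosis F - 1) / √(n N : ℝ) / D N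
  let b : ℕ → ℝ := fun N => if D N = 0 then 0 else √(kurtosis G - 1) / √(m N : ℝ) / D N
  have hDsq : ∀ N, D N ^ 2 = (kurtosis F - 1) / n N + (kurtosis G - 1) / m N := fun N =>
    Real.sq_sqrt (by positivity)
  have hab : ∀ N, a N ^ 2 + b N ^ 2 = 1 := by
    intro N
    by_cases h : D N = 0
    · simp [a, b, h]
    · have h2 : D N ^ 2 ≠ 0 := pow_ne_zero 2 h
      simp only [a, b, h, if_false, div_pow, Real.sq_sqrt hF0.le, Real.sq_sqrt hG0.le,
        Real.sq_sqrt (Nat.cast_nonneg _)]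
      rw [← add_div, ← hDsq, div_self h2]
  have hXm' : Measurable fun ω j => X j ω := measurable_pi_lambda _ hXm
  have hYm' : Measurable fun ω j => Y j ω := measurable_pi_lambda _ hYm
  have hL := tendstoInDistribution_mul_sub_mul hab
    (TendstoInDistribution.comp_atTop hn
      (tendstoInDistribution_logVarianceStat hF4 hF hXm hXlaw hXind))
    (TendstoInDistribution.comp_atTop hm
      (tendstoInDistribution_logVarianceStat hG4 hG hYm hYlaw hYind))
    (fun N => hXY.comp (measurable_logVarianceStat F (n N)) (measurable_logVarianceStat G (m N)))
  let r : ℕ → Ω → ℝ := fun N ω =>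
    a N ^ 2 * ((seqKurtosis (n N) (fun j => X j ω) - 1) / (kurtosis F - 1))
      + b N ^ 2 * ((seqKurtosis (m N) (fun j => Y j ω) - 1) / (kurtosis G - 1))
  have hrm : ∀ N, Measurable (r N) := fun N => by
    have h1 := (measurable_seqKurtosis (n N)).comp hXm'
    have h2 := (measurable_seqKurtosis (m N)).comp hYm'
    simp only [Function.comp_def] at h1 h2
    fun_prop
  have hr : ∀ᵐ ω ∂Q, Tendsto (fun N => (√(r N ω))⁻¹) atTop (𝓝 1) := by
    filter_upwards [ae_tendsto_seqKurtosis hF4 hF hXm hXlaw hXind,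
      ae_tendsto_seqKurtosis hG4 hG hYm hYlaw hYind] with ω h1 h2
    have h1' := ((((h1.comp hn).sub_const 1).div_const (kurtosis F - 1)).sub_const 1)
    have h2' := ((((h2.comp hm).sub_const 1).div_const (kurtosis G - 1)).sub_const 1)
    rw [div_self hF0.ne', sub_self] at h1'
    rw [div_self hG0.ne', sub_self] at h2'
    have ha : IsBoundedUnder (· ≤ ·) atTop (fun N => ‖a N ^ 2‖) :=
      isBoundedUnder_of ⟨1, fun N => by
        rw [Real.norm_of_nonneg (sq_nonneg _)]
        nlinarith [hab N, sq_nonneg (b N)]⟩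
    have hb : IsBoundedUnder (· ≤ ·) atTop (fun N => ‖b N ^ 2‖) :=
      isBoundedUnder_of ⟨1, fun N => by
        rw [Real.norm_of_nonneg (sq_nonneg _)]
        nlinarith [hab N, sq_nonneg (a N)]⟩
    have h3 := ((h1'.zero_mul_isBoundedUnder_le ha).add
      (h2'.zero_mul_isBoundedUnder_le hb)).add_const 1
    have h4 : Tendsto (fun N => r N ω) atTop (𝓝 1) := by
      rw [add_zero, zero_add] at h3
      refine h3.congr fun N => ?_
      simp only [Function.comp_apply, r]
      linear_combination -(hab N)
    simpa using h4.sqrt.inv₀ (by simp)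
  have hrm' : ∀ N, AEMeasurable (fun ω => (√(r N ω))⁻¹) Q := fun N =>
    (hrm N).sqrt.inv.aemeasurable
  have hfin := tendstoInDistribution_mul hL (tendstoInMeasure_of_ae_tendsto hrm' hr) hrm'
  simp only [id, one_mul] at hfin
  refine TendstoInDistribution.congr_eventually hfin ?_ fun N =>
    ((measurable_seqTkvar (n N) (m N)).comp (hXm'.prodMk hYm')).aemeasurable
  filter_upwards [hn.eventually_ne_atTop 0, hm.eventually_ne_atTop 0] with N hn0 hm0
  have hDpos : 0 < D N := Real.sqrt_pos.2 (by positivity)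
  funext ω
  exact (seqTkvar_eq hF hG hvar hn0 hm0 hDpos (if_neg hDpos.ne') (if_neg hDpos.ne')
    _ _).symm

end TwoSamples

section Transfer

variable {N : ℕ}

theorem armSize_one_add_armSize_zero (z : Fin N → Fin 2) : armSize z 1 + armSize z 0 = N := by
  have := Finset.card_eq_sum_card_fiberwise (s := Finset.univ) (t := Finset.univ) (f := z)
    (by simp [Set.MapsTo])
  rw [Fin.sum_univ_two, Finset.card_univ, Fintype.card_fin] at this
  simp only [armSize, arm]
  omega

/-- A numbering of the units within each arm. -/
noncomputable def rank (z : Fin N → Fin 2) (i : Fin N) : ℕ :=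
  (arm z (z i)).equivFin ⟨i, by simp [arm]⟩

theorem rank_eq (z : Fin N → Fin 2) {a : Fin 2} {i : Fin N} (hi : i ∈ arm z a) :
    rank z i = (arm z a).equivFin ⟨i, hi⟩ := by
  obtain rfl : z i = a := by simpa [arm] using hi
  rfl

theorem injective_arm_rank (z : Fin N → Fin 2) : Function.Injective fun i => (z i, rank z i) := by
  intro i j hij
  obtain ⟨h1, h2⟩ := Prod.mk.inj hij
  have hi : i ∈ arm z (z j) := by simp [arm, h1]
  rw [rank_eq z hi, rank, Fin.val_inj, EmbeddingLike.apply_eq_iff_eq] at h2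
  exact congrArg Subtype.val h2

theorem sum_arm (z : Fin N → Fin 2) (a : Fin 2) (g : ℕ → ℝ) :
    ∑ i ∈ arm z a, g (rank z i) = ∑ j ∈ Finset.range (armSize z a), g j := by
  rw [← Finset.sum_coe_sort, Finset.sum_range]
  exact Fintype.sum_equiv (arm z a).equivFin _ _ fun i => by rw [rank_eq z i.2]

variable (z : Fin N → Fin 2) (x : Fin 2 → ℕ → ℝ) (a : Fin 2)

theorem sum_arm_comp (g : ℝ → ℝ) : ∑ i ∈ arm z a, g (x (z i) (rank z i))
    = ∑ j ∈ Finset.range (armSize z a), g (x a j) := by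
  rw [← sum_arm z a fun j => g (x a j)]
  refine Finset.sum_congr rfl fun i hi => ?_
  rw [show z i = a by simpa [arm] using hi]

theorem sampleMean_eq_avg :
    sampleMean z (fun i => x (z i) (rank z i)) a = avg (armSize z a) (x a) := by
  rw [sampleMean, sum_arm_comp z x a fun t => t, avg]

theorem sampleVariance_eq_seqVariance :
    sampleVariance z (fun i => x (z i) (rank z i)) a = seqVariance (armSize z a) (x a) := by
  rw [sampleVariance, sampleMean_eq_avg, sum_arm_comp z x a fun t => (t - _) ^ 2, seqVariance]

theorem sampleKurtosis_eq_seqKurtosis :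
    sampleKurtosis z (fun i => x (z i) (rank z i)) a = seqKurtosis (armSize z a) (x a) := by
  have h (p : ℕ) : sampleCentralMoment z (fun i => x (z i) (rank z i)) a p
      = seqCentralMoment (armSize z a) (x a) p := by
    rw [sampleCentralMoment, sampleMean_eq_avg, sum_arm_comp z x a fun t => (t - _) ^ p,
      seqCentralMoment]
    rfl
  rw [sampleKurtosis, h, h, seqKurtosis]

theorem tkvar_eq_seqTkvar : tkvar z (fun i => x (z i) (rank z i))
    = seqTkvar (armSize z 1) (armSize z 0) (x 1) (x 0) := by
  simp only [tkvar, seqTkvar, sampleVariance_eq_seqVariance, sampleKurtosis_eq_seqKurtosis]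

theorem measurable_tkvar : Measurable (tkvar z) := by
  unfold tkvar sampleKurtosis sampleVariance sampleCentralMoment sampleMean
  fun_prop

theorem measurable_tkvar_observed : Measurable
    (fun p : (Fin N → Fin 2) × (Fin N → Fin 2 → ℝ) => tkvar p.1 (fun i => p.2 i (p.1 i))) := by
  refine measurable_from_prod_countable_right fun z => ?_
  exact (measurable_tkvar z).comp (measurable_pi_lambda _ fun i =>
    (measurable_pi_apply (z i)).comp (measurable_pi_apply i))

variable {Ω Ω' : Type*} [MeasurableSpace Ω] {P : Measure Ω}
  [MeasurableSpace Ω'] {Q : Measure Ω'} {F : Fin 2 → Measure ℝ}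
  {Y : Fin N → Fin 2 → Ω → ℝ} {Z : Fin N → Ω → Fin 2} {N₁ : ℕ}

theorem IsExperiment.aemeasurable_outcomes (h : IsExperiment P F Y Z N₁) :
    AEMeasurable (fun ω i a => Y i a ω) P :=
  aemeasurable_pi_lambda _ fun i => aemeasurable_pi_lambda _ fun a => (h.hasLaw i a).aemeasurable

theorem IsExperiment.aemeasurable_tkvar (h : IsExperiment P F Y Z N₁) :
    AEMeasurable (fun ω => tkvar (fun i => Z i ω) (observed Y Z ω)) P := by
  have hZ : AEMeasurable (fun ω i => Z i ω) P :=
    (measurable_pi_lambda _ h.measurable_assignment).aemeasurable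
  have := (measurable_tkvar_observed (N := N)).comp_aemeasurable
    (hZ.prodMk h.aemeasurable_outcomes)
  unfold observed
  simpa only [Function.comp_def] using this

/-- Given the assignment, the law of the statistic depends on the experiment only through the
sizes of the arms. -/
theorem IsExperiment.map_tkvar [IsProbabilityMeasure P] (h : IsExperiment P F Y Z N₁) {N₀ : ℕ} (hN : N₁ + N₀ = N)
    {X : Fin 2 → ℕ → Ω' → ℝ} (hX : ∀ a j, Measurable (X a j)) (hlaw : ∀ a j, Q.map (X a j) = F a)
    (hind : iIndepFun (fun (p : Fin 2 × ℕ) ω => X p.1 p.2 ω) Q) :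
    P.map (fun ω => tkvar (fun i => Z i ω) (observed Y Z ω))
      = Q.map (fun ω => seqTkvar N₁ N₀ (fun j => X 1 j ω) (fun j => X 0 j ω)) := by
  set T : (Fin N → Fin 2) × (Fin N → Fin 2 → ℝ) → ℝ :=
    fun p => tkvar p.1 (fun i => p.2 i (p.1 i)) with hT
  have hTm : Measurable T := measurable_tkvar_observed
  have hZm : Measurable fun ω i => Z i ω := measurable_pi_lambda _ h.measurable_assignment
  have hYm := h.aemeasurable_outcomes
  have hXm (a : Fin 2) : Measurable fun ω j => X a j ω := measurable_pi_lambda _ (hX a)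
  have hGm : Measurable fun ω => seqTkvar N₁ N₀ (fun j => X 1 j ω) (fun j => X 0 j ω) := by
    simpa only [Function.comp_def] using
      (measurable_seqTkvar N₁ N₀).comp ((hXm 1).prodMk (hXm 0))
  have hprod := (indepFun_iff_map_prod_eq_prod_map_map hZm.aemeasurable hYm).1 h.indep_assignment
  have hmap : P.map (fun ω => tkvar (fun i => Z i ω) (observed Y Z ω))
      = ((P.map fun ω i => Z i ω).prod (P.map fun ω i a => Y i a ω)).map T := by
    rw [← hprod, AEMeasurable.map_map_of_aemeasurable hTm.aemeasurable
      (hZm.aemeasurable.prodMk hYm)]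
    unfold observed
    simp only [hT, Function.comp_def]
  have : IsProbabilityMeasure (P.map fun ω i => Z i ω) :=
    Measure.isProbabilityMeasure_map hZm.aemeasurable
  have : IsProbabilityMeasure (P.map fun ω i a => Y i a ω) :=
    Measure.isProbabilityMeasure_map hYm
  have hsize : ∀ᵐ z ∂(P.map fun ω i => Z i ω), armSize z 1 = N₁ :=
    (ae_map_iff hZm.aemeasurable (Set.toFinite _).measurableSet).2 h.card_treated
  ext S hS
  rw [hmap, Measure.map_apply hTm hS, Measure.prod_apply (hTm hS)]
  have hconst : ∀ᵐ z ∂(P.map fun ω i => Z i ω),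
      (P.map fun ω i a => Y i a ω) (Prod.mk z ⁻¹' (T ⁻¹' S))
        = Q.map (fun ω => seqTkvar N₁ N₀ (fun j => X 1 j ω) (fun j => X 0 j ω)) S := by
    filter_upwards [hsize] with z hz
    have hz0 : armSize z 0 = N₀ := by
      have := armSize_one_add_armSize_zero z
      omega
    have hid : IdentDistrib (fun ω i => Y i (z i) ω) (fun ω i => X (z i) (rank z i) ω) P Q :=
      IdentDistrib.pi (fun i => ⟨(h.hasLaw i (z i)).aemeasurable, (hX _ _).aemeasurable,
          by rw [(h.hasLaw i (z i)).map_eq, hlaw]⟩)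
        (h.indep_units.comp (fun i (y : Fin 2 → ℝ) => y (z i)) fun i => measurable_pi_apply _)
        (hind.precomp (injective_arm_rank z))
    have := (hid.comp (measurable_tkvar z)).measure_mem_eq hS
    have hset : (fun ω i a => Y i a ω) ⁻¹' (Prod.mk z ⁻¹' (T ⁻¹' S))
        = (tkvar z ∘ fun ω i => Y i (z i) ω) ⁻¹' S := by
      ext ω
      simp only [Set.mem_preimage, Function.comp_apply, hT]
    have hfun : (fun ω => seqTkvar N₁ N₀ (fun j => X 1 j ω) (fun j => X 0 j ω))
        = tkvar z ∘ fun ω i => X (z i) (rank z i) ω := by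
      funext ω
      rw [Function.comp_apply, tkvar_eq_seqTkvar z fun a j => X a j ω, hz, hz0]
    rw [Measure.map_apply_of_aemeasurable hYm (measurable_prodMk_left (hTm hS)),
      Measure.map_apply hGm hS, hset, hfun, this]
  rw [lintegral_congr_ae hconst]
  simp

end Transfer

end VarianceRatio

theorem mainTheorem4
    (F : Fin 2 → Measure ℝ) [∀ a, IsProbabilityMeasure (F a)]
    -- finite kurtosis of both potential-outcome distributions
    (hF4 : ∀ a, MemLp id 4 (F a))
    -- non-degeneracy: this excludes only point masses and symmetric two-point distributions
    (hκ : ∀ a, 1 < VarianceRatio.kurtosis (F a))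
    -- null hypothesis of equal variances
    (hnull : Var[id; F 1] = Var[id; F 0])
    -- for each `N`, an experiment on `N` units with `N₁ N` treated and `N₀ N` control units
    (N₁ N₀ : ℕ → ℕ) (hN : ∀ N, N₁ N + N₀ N = N)
    (hN₁ : Tendsto N₁ atTop atTop) (hN₀ : Tendsto N₀ atTop atTop)
    {Ω : ℕ → Type*} [∀ N, MeasurableSpace (Ω N)]
    (P : ∀ N, Measure (Ω N)) [∀ N, IsProbabilityMeasure (P N)]
    (Y : ∀ N, Fin N → Fin 2 → Ω N → ℝ) (Z : ∀ N, Fin N → Ω N → Fin 2)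
    (hexp : ∀ N, VarianceRatio.IsExperiment (P N) F (Y N) (Z N) (N₁ N)) :
    -- convergence in distribution to the standard normal law
    TendstoInDistribution
      (fun N ω => VarianceRatio.tkvar (fun i => Z N i ω) (VarianceRatio.observed (Y N) (Z N) ω))
      atTop (id : ℝ → ℝ) P (gaussianReal 0 1) ∧
    -- hence the one-sided and the two-sided test have asymptotically distribution-free levels
    (∀ c : ℝ, Tendsto
      (fun N => P N {ω | c < VarianceRatio.tkvar (fun i => Z N i ω)
        (VarianceRatio.observed (Y N) (Z N) ω)})
      atTop (𝓝 (gaussianReal 0 1 {x | c < x}))) ∧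
    (∀ c : ℝ, Tendsto
      (fun N => P N {ω | c < |VarianceRatio.tkvar (fun i => Z N i ω)
        (VarianceRatio.observed (Y N) (Z N) ω)|})
      atTop (𝓝 (gaussianReal 0 1 {x | c < |x|}))) := by
  open VarianceRatio in
  let Q : Measure (Fin 2 → ℕ → ℝ) := Measure.infinitePi fun a => Measure.infinitePi fun _ : ℕ => F a
  let X : Fin 2 → ℕ → (Fin 2 → ℕ → ℝ) → ℝ := fun a j ω => ω a j
  have hXm : ∀ a j, Measurable (X a j) := fun a j => by fun_prop
  have hXlaw : ∀ a j, Q.map (X a j) = F a := fun a j =>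
    ((measurePreserving_eval_infinitePi (fun _ : ℕ => F a) j).comp
      (measurePreserving_eval_infinitePi (fun a => Measure.infinitePi fun _ : ℕ => F a) a)).map_eq
  have hXind : iIndepFun (fun (p : Fin 2 × ℕ) ω => X p.1 p.2 ω) Q :=
    iIndepFun_uncurry_infinitePi' (X := fun _ _ => id) (fun a _ => F a) fun _ _ => measurable_id
  have harm : ∀ a, iIndepFun (X a) Q := fun a =>
    hXind.precomp (g := fun j => (a, j)) fun _ _ h => (Prod.mk.inj h).2
  have harms : IndepFun (fun ω j => X 1 j ω) (fun ω j => X 0 j ω) Q :=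
    (iIndepFun_infinitePi (P := fun a => Measure.infinitePi fun _ : ℕ => F a)
      (X := fun _ => id) fun _ => measurable_id).indepFun (by decide)
  have hQ := tendstoInDistribution_seqTkvar (hF4 1) (hF4 0) (hκ 1) (hκ 0) hnull (hXm 1) (hXm 0)
    (hXlaw 1) (hXlaw 0) (harm 1) (harm 0) harms hN₁ hN₀
  have hmain : TendstoInDistribution
      (fun N ω => tkvar (fun i => Z N i ω) (observed (Y N) (Z N) ω))
      atTop (id : ℝ → ℝ) P (gaussianReal 0 1) :=
    { forall_aemeasurable := fun N => (hexp N).aemeasurable_tkvar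
      aemeasurable_limit := aemeasurable_id
      tendsto := by
        refine hQ.tendsto.congr fun N => Subtype.ext ?_
        exact ((hexp N).map_tkvar (hN N) hXm hXlaw hXind).symm }
  have hnull' {S T : Set ℝ} (hS : frontier S ⊆ T) (hT : T.Finite) :
      (gaussianReal 0 1).map id (frontier S) = 0 := by
    have := nullSingletonClass_gaussianReal (μ := 0) (v := 1) one_ne_zero
    rw [Measure.map_id]
    exact measure_mono_null hS (hT.measure_zero _)
  refine ⟨hmain, fun c => ?_, fun c => ?_⟩
  · have := tendsto_measure_of_tendstoInDistribution hmain (S := {x | c < x}) measurableSet_Ioi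
      (hnull' (T := {c}) (frontier_Ioi (a := c)).subset (Set.finite_singleton c))
    rwa [Measure.map_id] at this
  · have := tendsto_measure_of_tendstoInDistribution hmain (S := {x | c < |x|})
      (measurableSet_lt measurable_const (by fun_prop))
      (hnull' (T := {c, -c}) (fun x hx => ?_) (Set.toFinite _))
    · rwa [Measure.map_id] at this
    · have : c = |x| := frontier_lt_subset_eq continuous_const continuous_abs hx
      rcases abs_choice x with h | h
      · exact Or.inl (by rw [this, h])
      · exact Or.inr (by rw [Set.mem_singleton_iff, this, h, neg_neg])
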